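/- Let $G$ be a finitely generated group, let $H \le G$ be a subgroup of finite index with inclusion $\iota : H \hookrightarrow G$, and suppose that $r_0(G_{ab}) = r_0(H_{ab})$, where $r_0$ denotes the torsion-free rank of an abelian group and $G_{ab}$, $H_{ab}$ are the abelianisations. Let $A$ be a left $\mathbb{Z}G$-module, regarded also as a $\mathbb{Z}H$-module by restriction. For a finitely generated group $\Gamma$ let $S(\Gamma)$ be the set of classes $[\chi]$ of nonzero homomorphisms $\chi : \Gamma \to \mathbb{R}$, where $\chi$ and $\chi'$ are identified if $\chi = a\chi'$ for some real $a > 0$; it carries the quotient topology from $\mathrm{Hom}(\Gamma, \mathbb{R}) \setminus \{0\}$. For $n \ge 0$, a left module over a ring $R$ is of type $\mathrm{FP}_n$ over $R$ if it has a resolution $\cdots \to P_1 \to P_0$ by free left $R$-modules with $P_i$ finitely generated for all $i \le n$. For a left $\mathbb{Z}\Gamma$-module $A$ let $\Sigma^n(\Gamma, A) \subseteq S(\Gamma)$ be the set of all $[\chi]$ such that $A$ is of type $\mathrm{FP}_n$ over the subring $\mathbb{Z}\Gamma_\chi \subseteq \mathbb{Z}\Gamma$, where $\Gamma_\chi = \{g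 \in \Gamma : \chi(g) \ge 0\}$. Then every nonzero homomorphism $\chi : G \to \mathbb{R}$ has nonzero restriction $\chi|_H$, and $\iota^*([\chi]) = [\chi|_H]$ is a well-defined homeomorphism $\iota^* : S(G) \to S(H)$. Moreover, for every $n \ge 0$ such that $A$ is of type $\mathrm{FP}_n$ over $\mathbb{Z}G$, $$\iota^*(\Sigma^n(G, A)) = \Sigma^n(H, A).$$ -/

import Mathlib

universe u v

/-- A left `R`-module `A` is of type `FP_n` over `R` if it has a resolution
`⋯ → P 2 → P 1 → P 0 → A → 0` by free left `R`-modules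
with `P i` finitely generated for all `i ≤ n`. -/
def IsTypeFP (R : Type u) [Ring R] (A : Type v) [AddCommGroup A] [Module R A] (n : ℕ) : Prop :=
  ∃ (P : ℕ → ModuleCat.{max u v} R) (d : ∀ i, P (i + 1) →ₗ[R] P i) (ε : P 0 →ₗ[R] A),
    (∀ i, Module.Free R (P i)) ∧
    (∀ i, i ≤ n → Module.Finite R (P i)) ∧
    Function.Surjective ε ∧
    Function.Exact (d 0) ε ∧
    ∀ i, Function.Exact (d (i + 1)) (d i)

/-- The torsion-free rank `r₀(G_ab)` of the abelianisation of `G`: the rank of `G_ab` as a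
`ℤ`-module, that is, the supremum of the cardinalities of its `ℤ`-linearly independent subsets. -/
noncomputable def abRank (G : Type u) [Group G] : Cardinal.{u} :=
  Module.rank ℤ (Additive (Abelianization G))

/-- The nontrivial characters of `G`, i.e. the nonzero homomorphisms from `G` to `(ℝ, +)`. -/
def NontrivialCharacter (G : Type u) [Group G] : Type u :=
  {χ : Additive G →+ ℝ // χ ≠ 0}

namespace NontrivialCharacter

variable {G : Type u} [Group G]

/-- The value `χ(g)`. -/
def eval (χ : NontrivialCharacter G) (g : G) : ℝ := χ.1 (Additive.ofMul g)

/-- `Hom(G, ℝ)` carries the topology of pointwise convergence. For finitely generated `G` this is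
the usual topology of a finite-dimensional real vector space. The nontrivial characters
form a subspace. -/
instance : TopologicalSpace (NontrivialCharacter G) :=
  TopologicalSpace.induced eval inferInstance

/-- `χ ∼ ψ` if and only if `χ = a ψ` for some real `a > 0`. -/
instance setoid (G : Type u) [Group G] : Setoid (NontrivialCharacter G) where
  r χ ψ := ∃ a : ℝ, 0 < a ∧ ∀ g : G, χ.eval g = a * ψ.eval g
  iseqv :=
    { refl := fun χ => ⟨1, one_pos, fun g => (one_mul _).symm⟩
      symm := by
        rintro χ ψ ⟨a, ha, h⟩
        exact ⟨a⁻¹, inv_pos.mpr ha, fun g => by rw [h, inv_mul_cancel_left₀ ha.ne']⟩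
      trans := by
        rintro χ ψ φ ⟨a, ha, h⟩ ⟨b, hb, h'⟩
        exact ⟨a * b, mul_pos ha hb, fun g => by rw [h, h', mul_assoc]⟩ }

/-- The subring `ℤG_χ` of `ℤG`, where `G_χ = {g ∈ G | χ(g) ≥ 0}`: the elements of the group ring
that are supported on the submonoid `G_χ`. -/
def subring (χ : NontrivialCharacter G) : Subring (MonoidAlgebra ℤ G) where
  carrier := {x | ∀ g ∈ x.coeff.support, 0 ≤ χ.eval g}
  zero_mem' := by simp
  one_mem' := by
    intro g hg
    have hg' : g = 1 := by
      simpa using MonoidAlgebra.support_coeff_one_subset hg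
    simp [hg', eval]
  add_mem' := by
    classical
    intro x y hx hy g hg
    rw [MonoidAlgebra.coeff_add] at hg
    exact (Finset.mem_union.1 (Finsupp.support_add hg)).elim (hx g) (hy g)
  neg_mem' := by
    intro x hx g hg
    exact hx g (by simpa using hg)
  mul_mem' := by
    classical
    intro x y hx hy g hg
    obtain ⟨a, ha, b, hb, rfl⟩ := Finset.mem_mul.1 (MonoidAlgebra.support_coeff_mul_subset x y hg)
    have h : χ.eval (a * b) = χ.eval a + χ.eval b := by simp [eval]
    rw [h]
    exact add_nonneg (hx a ha) (hy b hb)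

theorem subring_eq_of_equiv {χ ψ : NontrivialCharacter G} (h : χ ≈ ψ) :
    χ.subring = ψ.subring := by
  obtain ⟨a, ha, h⟩ := h
  ext x
  change (∀ g ∈ x.coeff.support, 0 ≤ χ.eval g) ↔ (∀ g ∈ x.coeff.support, 0 ≤ ψ.eval g)
  simp only [h, mul_nonneg_iff_of_pos_left ha]

end NontrivialCharacter

/-- The character sphere `S(G)`, with the quotient topology. -/
def CharacterSphere (G : Type u) [Group G] : Type u :=
  Quotient (NontrivialCharacter.setoid G)

instance (G : Type u) [Group G] : TopologicalSpace (CharacterSphere G) :=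
  inferInstanceAs (TopologicalSpace (Quotient (NontrivialCharacter.setoid G)))

/-- The class `[χ] ∈ S(G)` of a nonzero homomorphism `χ : G → ℝ`. -/
def CharacterSphere.mk {G : Type u} [Group G] (χ : Additive G →+ ℝ) (hχ : χ ≠ 0) :
    CharacterSphere G :=
  Quotient.mk (NontrivialCharacter.setoid G) ⟨χ, hχ⟩

/-- The homological invariant `Σⁿ(G, A)`: the set of all `[χ] ∈ S(G)` such that `A` is of type
`FP_n` over the subring `ℤG_χ` of `ℤG`. -/
def sigmaInvariant (n : ℕ) (G : Type u) [Group G] (A : Type v) [AddCommGroup A]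
    [Module (MonoidAlgebra ℤ G) A] : Set (CharacterSphere G) :=
  {s | Quotient.lift (fun χ : NontrivialCharacter G => IsTypeFP χ.subring A n)
    (fun χ ψ h => by
      show IsTypeFP χ.subring A n = IsTypeFP ψ.subring A n
      rw [NontrivialCharacter.subring_eq_of_equiv h]) s}

/-- The invariant `Σⁿ(H, A) ⊆ S(H)` of a subgroup `H ≤ G` and a `ℤG`-module `A`, which is regarded
as a `ℤH`-module by restriction along `ℤH → ℤG`. -/
def sigmaInvariantSubgroup (n : ℕ) {G : Type u} [Group G] (H : Subgroup G) (A : Type v)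
    [AddCommGroup A] [Module (MonoidAlgebra ℤ G) A] : Set (CharacterSphere H) :=
  letI : Module (MonoidAlgebra ℤ H) A :=
    Module.compHom A (MonoidAlgebra.mapDomainRingHom ℤ H.subtype)
  sigmaInvariant n H A

/-- The restriction `χ|_H` of a homomorphism `χ : G → ℝ` to a subgroup `H`. -/
def restrictCharacter {G : Type u} [Group G] (H : Subgroup G) (χ : Additive G →+ ℝ) :
    Additive H →+ ℝ :=
  χ.comp (MonoidHom.toAdditive H.subtype)

/-!
# Homological Sigma-invariants and subgroups of finite index

**Characters.** Every `g : G` has a power `g ^ k` in `H` with `k ≠ 0`, so `χ(g) = χ(g ^ k) / k` is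
determined by `χ|_H` and depends continuously on it. Equality of the ranks makes the kernel of
`H_ab → G_ab` a torsion group, and its cokernel is torsion anyway; so each character of `H`
extends to `G` (`exists_extension_of_rank_eq`). Restriction is therefore a homeomorphism between
the spaces of nontrivial characters, compatible with positive scaling
(`CharacterSphere.restrictHomeomorph`).

**Invariants.** It remains to see that a `ℤG`-module `A` is of type `FP_n` over `ℤG_χ` if and only if
it is so over `ℤH_χ` (`isTypeFP_restrict_iff`). The larger ring is in general not finitely
generated over the smaller one, namely when `χ(G)` is dense in `ℝ` and larger than `χ(H)`, so a
resolution over one ring cannot simply be restricted to the other. Instead, both conditions are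
read off from one complex, a free resolution `P` of `A` over `ℤG`.

Call a subset of a module bounded if it lies in a finitely generated submodule. In the spirit of
Brown's criterion, a module with a resolution `P` is of type `FP_n` if and only if it is finitely
generated and, in degrees below `n`, the boundaries in any bounded set are the image of a bounded
set (`IsControlled`, `isTypeFP_iff_isControlled`). For this `P` need not be finitely generated nor
projective: it is enough that each finitely generated submodule of `P i` lies in a finitely
generated projective one, because chain maps and homotopies between two such resolutions exist on
finitely generated pieces (`exists_comparison`), and they preserve boundedness
(`IsControlled.transfer`). Free modules over `ℤG` have this property over `ℤG_χ`
(`isLocallyProjective_subring`), and, being free over `ℤH` as well (`free_restrict`), also over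
`ℤH_χ`. Finally the condition refers to the ring only through the bounded sets, and these are the
same for `ℤG_χ` and `ℤH_χ` (`isFGBounded_restrict_iff`).
-/

/-! ### Finiteness type through locally projective resolutions -/

section Homological

variable {S : Type*} [Ring S]

/-- A subset of an `S`-module is finitely generated bounded if it lies in a finitely generated
submodule. It is a property of sets rather than of submodules so that the notions for different
rings acting on the same group can be compared. -/
def IsFGBounded (S : Type*) [Ring S] {M : Type*} [AddCommGroup M] [Module S M]
    (X : Set M) : Prop :=
  ∃ N : Submodule S M, N.FG ∧ X ⊆ N

/-- An `S`-module is locally projective if each finitely generated submodule lies in a finitely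
generated projective submodule. -/
def IsLocallyProjective (S : Type*) [Ring S] (M : Type*) [AddCommGroup M] [Module S M] : Prop :=
  ∀ N : Submodule S M, N.FG → ∃ L : Submodule S M, N ≤ L ∧ L.FG ∧ Module.Projective S L

/-- `A` is finitely generated and, in degrees `i < n`, the boundaries lying in a bounded subset of
`P i` are the images of a bounded subset of `P (i + 1)`. The maps `d` are bare functions and the
augmentation is absent, so that the ring `S` enters only through its bounded subsets. -/
def IsControlled (S : Type*) [Ring S] (A : Type*) [AddCommGroup A] [Module S A]
    {P : ℕ → Type*} [∀ i, AddCommGroup (P i)] [∀ i, Module S (P i)]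
    (d : ∀ i, P (i + 1) → P i) (n : ℕ) : Prop :=
  IsFGBounded S (Set.univ : Set A) ∧ ∀ i < n, ∀ X : Set (P i), IsFGBounded S X →
    ∃ Y : Set (P (i + 1)), IsFGBounded S Y ∧ X ∩ Set.range (d i) ⊆ d i '' Y

theorem Module.Finite.isFGBounded {M : Type*} [AddCommGroup M] [Module S M] [Module.Finite S M]
    (X : Set M) : IsFGBounded S X :=
  ⟨⊤, Module.Finite.fg_top, fun _ _ => trivial⟩

theorem isFGBounded_univ_iff {M : Type*} [AddCommGroup M] [Module S M] :
    IsFGBounded S (Set.univ : Set M) ↔ Module.Finite S M := by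
  refine ⟨fun ⟨N, hN, h⟩ => ⟨?_⟩, fun _ => Module.Finite.isFGBounded _⟩
  rwa [← top_unique fun x _ => h (Set.mem_univ x)]

theorem IsLocallyProjective.of_free {M : Type*} [AddCommGroup M] [Module S M]
    [Module.Free S M] : IsLocallyProjective S M := by
  classical
  intro N hN
  obtain ⟨T, rfl⟩ := hN
  let b := Module.Free.chooseBasis S M
  let J := T.biUnion fun x => (b.repr x).support
  have hli : LinearIndependent S fun j : J => b j :=
    b.linearIndependent.comp _ Subtype.val_injective
  refine ⟨Submodule.span S (Set.range fun j : J => b j), ?_, ?_, ?_⟩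
  · rw [Submodule.span_le]
    intro x hx
    rw [← b.linearCombination_repr x, Finsupp.linearCombination_apply, Finsupp.sum]
    refine Submodule.sum_mem _ fun j hj => Submodule.smul_mem _ _ (Submodule.subset_span ?_)
    exact ⟨⟨j, Finset.mem_biUnion.2 ⟨x, hx, hj⟩⟩, rfl⟩
  · exact Submodule.fg_span (Set.finite_range _)
  · exact Module.Projective.of_basis (Module.Basis.span hli)

/-- A linear map from a projective module lifts through any linear map whose range contains its
values. -/
theorem exists_lift_of_range_le {L M N : Type*} [AddCommGroup L] [Module S L] [AddCommGroup M]
    [Module S M] [AddCommGroup N] [Module S N] [Module.Projective S L] (p : M →ₗ[S] N)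
    (f : L →ₗ[S] N) (h : ∀ x, ∃ y, p y = f x) : ∃ g : L →ₗ[S] M, ∀ x, p (g x) = f x := by
  obtain ⟨g, hg⟩ := Module.projective_lifting_property p.rangeRestrict
    (f.codRestrict (LinearMap.range p) fun x => h x) p.surjective_rangeRestrict
  exact ⟨g, fun x => congrArg Subtype.val (LinearMap.congr_fun hg x)⟩

variable {A : Type*} [AddCommGroup A] [Module S A]
  {P : ℕ → Type*} [∀ i, AddCommGroup (P i)] [∀ i, Module S (P i)]
  {Q : ℕ → Type*} [∀ i, AddCommGroup (Q i)] [∀ i, Module S (Q i)]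

/-- The maps `d` and the augmentation `ε` make `P` a resolution of `A`; nothing is asked of the
modules `P i`. -/
structure IsResolution (d : ∀ i, P (i + 1) →ₗ[S] P i) (ε : P 0 →ₗ[S] A) : Prop where
  surjective : Function.Surjective ε
  exact_zero : Function.Exact (d 0) ε
  exact_succ : ∀ i, Function.Exact (d (i + 1)) (d i)

/-- Comparison of two locally projective resolutions `P` and `Q` of the same module, one degree at a
time. Only finitely generated pieces are projective, so chain maps exist only on these: each
finitely generated projective `L ⊆ Q i` has a map `g` to `P i`, and each finitely generated
projective `M ⊆ P i` containing the image of `g` has a map `f` to `Q i`, such that `f ∘ g` is the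
inclusion up to a homotopy `h` on the boundaries in `L`. Here `f` and `h` are allowed to depend
on `M`, which is what makes an induction on `i` possible. -/
theorem exists_comparison {d : ∀ i, P (i + 1) →ₗ[S] P i} {ε : P 0 →ₗ[S] A}
    {d' : ∀ i, Q (i + 1) →ₗ[S] Q i} {ε' : Q 0 →ₗ[S] A}
    (hP : IsResolution d ε) (hQ : IsResolution d' ε')
    (lP : ∀ i, IsLocallyProjective S (P i)) (lQ : ∀ i, IsLocallyProjective S (Q i)) (i : ℕ) :
    ∀ L : Submodule S (Q i), L.FG → Module.Projective S L →
      ∃ g : L →ₗ[S] P i, (∀ x : L, (x : Q i) ∈ Set.range (d' i) → g x ∈ Set.range (d i)) ∧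
        ∀ M : Submodule S (P i), M.FG → Module.Projective S M →
          ∀ hM : ∀ x, g x ∈ M, ∃ f : M →ₗ[S] Q i,
            (∀ y : M, (y : P i) ∈ Set.range (d i) → f y ∈ Set.range (d' i)) ∧
            ∃ h : L →ₗ[S] Q (i + 1), ∀ x : L, (x : Q i) ∈ Set.range (d' i) →
              d' i (h x) = x - f ⟨g x, hM x⟩ := by
  induction i with
  | zero =>
    intro L _ _
    obtain ⟨g, hg⟩ := exists_lift_of_range_le ε (ε'.comp L.subtype) fun x => hP.surjective _
    refine ⟨g, fun x hx => (hP.exact_zero _).1 ?_, fun M _ _ hM => ?_⟩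
    · rw [hg]; exact (hQ.exact_zero _).2 hx
    obtain ⟨f, hf⟩ := exists_lift_of_range_le ε' (ε.comp M.subtype) fun x => hQ.surjective _
    refine ⟨f, fun x hx => (hQ.exact_zero _).1 ?_, ?_⟩
    · rw [hf]; exact (hP.exact_zero _).2 hx
    obtain ⟨h, hh⟩ := exists_lift_of_range_le (d' 0)
      (L.subtype - f.comp (g.codRestrict M hM)) fun x => by
        refine (hQ.exact_zero _).1 ?_
        have h2 := hf (g.codRestrict M hM x)
        have h1 := hg x
        simp only [LinearMap.sub_apply, map_sub, LinearMap.comp_apply, h2]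
        simpa using sub_eq_zero.2 h1.symm
    exact ⟨h, fun x _ => hh x⟩
  | succ i ih =>
    intro L hL _
    obtain ⟨L₀, hLL₀, hL₀, hL₀p⟩ := lQ i (L.map (d' i)) (hL.map _)
    obtain ⟨g₀, hg₀, H⟩ := ih L₀ hL₀ hL₀p
    have hdL : ∀ x : L, d' i x ∈ L₀ := fun x => hLL₀ ⟨x, x.2, rfl⟩
    let δ : L →ₗ[S] L₀ := ((d' i).comp L.subtype).codRestrict L₀ hdL
    -- The maps in degree `i + 1` lift those in degree `i`, composed with the differentials.
    obtain ⟨g, hg⟩ := exists_lift_of_range_le (d i) (g₀.comp δ) fun x => hg₀ (δ x) ⟨x, rfl⟩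
    have hδ : ∀ x : L, (x : Q (i + 1)) ∈ Set.range (d' (i + 1)) → δ x = 0 := fun x hx =>
      Subtype.ext ((hQ.exact_succ i _).2 hx)
    refine ⟨g, fun x hx => (hP.exact_succ i _).1 ?_, fun M hMfg _ hM => ?_⟩
    · rw [hg, LinearMap.comp_apply, hδ x hx, map_zero]
    obtain ⟨M₀, hMM₀, hM₀, hM₀p⟩ := lP i (M.map (d i) ⊔ LinearMap.range g₀)
      ((hMfg.map _).sup (by
        have : Module.Finite S L₀ := Module.Finite.iff_fg.2 hL₀
        exact Module.Finite.iff_fg.1 inferInstance))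
    obtain ⟨f₀, hf₀, h₀, hh₀⟩ := H M₀ hM₀ hM₀p fun x => hMM₀ (Submodule.mem_sup_right ⟨x, rfl⟩)
    have hdM : ∀ y : M, d i y ∈ M₀ := fun y => hMM₀ (Submodule.mem_sup_left ⟨y, y.2, rfl⟩)
    let δ' : M →ₗ[S] M₀ := ((d i).comp M.subtype).codRestrict M₀ hdM
    obtain ⟨f, hf⟩ := exists_lift_of_range_le (d' i) (f₀.comp δ') fun y => hf₀ (δ' y) ⟨y, rfl⟩
    refine ⟨f, fun y hy => (hQ.exact_succ i _).1 ?_, ?_⟩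
    · have : δ' y = 0 := Subtype.ext ((hP.exact_succ i _).2 hy)
      rw [hf, LinearMap.comp_apply, this, map_zero]
    obtain ⟨h, hh⟩ := exists_lift_of_range_le (d' (i + 1))
      (L.subtype - f.comp (g.codRestrict M hM) - h₀.comp δ) fun x => by
        refine (hQ.exact_succ i _).1 ?_
        have h3 : d' i (h₀ (δ x)) = d' i x - f₀ _ := hh₀ (δ x) ⟨x, rfl⟩
        have h4 : δ' (g.codRestrict M hM x) = ⟨g₀ (δ x), hMM₀ (Submodule.mem_sup_right ⟨δ x, rfl⟩)⟩ :=
          Subtype.ext (hg x)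
        have h5 := hf (g.codRestrict M hM x)
        simp only [LinearMap.sub_apply, map_sub, LinearMap.comp_apply, h5, h3, h4,
          Submodule.subtype_apply]
        abel
    refine ⟨h, fun x hx => ?_⟩
    rw [hh, LinearMap.sub_apply, LinearMap.comp_apply h₀, hδ x hx, map_zero, sub_zero]
    rfl

/-- Being controlled does not depend on the locally projective resolution. -/
theorem IsControlled.transfer {d : ∀ i, P (i + 1) →ₗ[S] P i} {ε : P 0 →ₗ[S] A}
    {d' : ∀ i, Q (i + 1) →ₗ[S] Q i} {ε' : Q 0 →ₗ[S] A}
    (hP : IsResolution d ε) (hQ : IsResolution d' ε')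
    (lP : ∀ i, IsLocallyProjective S (P i)) (lQ : ∀ i, IsLocallyProjective S (Q i)) {n : ℕ}
    (h : IsControlled S A (fun i => d i) n) : IsControlled S A (fun i => d' i) n := by
  refine ⟨h.1, fun i hi X ⟨N, hN, hXN⟩ => ?_⟩
  obtain ⟨L, hNL, hL, hLp⟩ := lQ i N hN
  obtain ⟨g, hg, H⟩ := exists_comparison hP hQ lP lQ i L hL hLp
  have : Module.Finite S L := Module.Finite.iff_fg.2 hL
  have hgL : (LinearMap.range g).FG := Module.Finite.iff_fg.1 inferInstance
  obtain ⟨Y, ⟨N', hN', hYN'⟩, hY⟩ := h.2 i hi _ ⟨_, hgL, subset_rfl⟩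
  obtain ⟨M', hNM', hM', hMp'⟩ := lP (i + 1) N' hN'
  obtain ⟨M, hMM, hM, hMp⟩ := lP i (M'.map (d i) ⊔ LinearMap.range g) ((hM'.map _).sup hgL)
  obtain ⟨f, hf, e, he⟩ := H M hM hMp fun x => hMM (Submodule.mem_sup_right ⟨x, rfl⟩)
  have hdM : ∀ y : M', d i y ∈ M := fun y => hMM (Submodule.mem_sup_left ⟨y, y.2, rfl⟩)
  let δ : M' →ₗ[S] M := ((d i).comp M'.subtype).codRestrict M hdM
  obtain ⟨f', hf'⟩ := exists_lift_of_range_le (d' i) (f.comp δ) fun y => hf (δ y) ⟨y, rfl⟩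
  have : Module.Finite S M' := Module.Finite.iff_fg.2 hM'
  have hfM : (LinearMap.range f').FG := Module.Finite.iff_fg.1 inferInstance
  have heL : (LinearMap.range e).FG := Module.Finite.iff_fg.1 inferInstance
  refine ⟨_, ⟨_, hfM.sup heL, subset_rfl⟩, ?_⟩
  rintro z ⟨hzX, hz⟩
  let z' : L := ⟨z, hNL (hXN hzX)⟩
  obtain ⟨y, hyY, hy⟩ := hY ⟨⟨z', rfl⟩, hg z' hz⟩
  let y' : M' := ⟨y, hNM' (hYN' hyY)⟩
  -- `z = f (g z) + d (e z)` and `g z = d y`, hence `z = d (f' y + e z)`.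
  refine ⟨f' y' + e z', Submodule.add_mem_sup ⟨_, rfl⟩ ⟨_, rfl⟩, ?_⟩
  have h1 := he z' hz
  have h2 := hf' y'
  have h3 : δ y' = ⟨g z', hMM (Submodule.mem_sup_right ⟨z', rfl⟩)⟩ := Subtype.ext hy
  simp only [map_add, h1, h2, LinearMap.comp_apply, h3]
  exact add_sub_cancel _ _

theorem isControlled_of_finite {d : ∀ i, P (i + 1) →ₗ[S] P i} {ε : P 0 →ₗ[S] A}
    (hP : IsResolution d ε) {n : ℕ} (hfin : ∀ i ≤ n, Module.Finite S (P i)) :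
    IsControlled S A (fun i => d i) n := by
  have := hfin 0 n.zero_le
  refine ⟨isFGBounded_univ_iff.2 (Module.Finite.of_surjective ε hP.surjective), fun i hi X _ => ?_⟩
  have := hfin (i + 1) hi
  exact ⟨Set.univ, Module.Finite.isFGBounded _, fun z hz => by simpa using hz.2⟩

/-- In a controlled resolution that is finitely generated in a degree whenever the preceding
boundaries allow it, finite generation propagates from degree to degree: once `P i` is finitely
generated, all of it is bounded, so `range (d i)` is finitely generated. -/
theorem IsControlled.finite {d : ∀ i, P (i + 1) →ₗ[S] P i} {n : ℕ}
    (h : IsControlled S A (fun i => d i) n)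
    (h0 : Module.Finite S A → Module.Finite S (P 0))
    (hs : ∀ i, (LinearMap.range (d i)).FG → Module.Finite S (P (i + 1))) :
    ∀ i ≤ n, Module.Finite S (P i)
  | 0, _ => h0 (isFGBounded_univ_iff.1 h.1)
  | i + 1, hi => by
    have := IsControlled.finite h h0 hs i (i.le_succ.trans hi)
    refine hs i ?_
    obtain ⟨Y, ⟨N, hN, hYN⟩, hY⟩ := h.2 i hi Set.univ (Module.Finite.isFGBounded _)
    convert hN.map (d i)
    refine le_antisymm (fun z hz => ?_) (LinearMap.map_le_range)
    obtain ⟨y, hy, rfl⟩ := hY ⟨trivial, hz⟩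
    exact ⟨y, hYN hy, rfl⟩

end Homological

/-! ### Resolutions that are finitely generated whenever possible -/

section EconomicalResolution

variable (R : Type u) [Ring R]

theorem exists_economical_generators (K : Type*) [AddCommGroup K] [Module R K] :
    ∃ T : Set K, Submodule.span R T = ⊤ ∧ (Module.Finite R K → T.Finite) := by
  by_cases h : Module.Finite R K
  · obtain ⟨T, hT⟩ := h.fg_top
    exact ⟨T, hT, fun _ => T.finite_toSet⟩
  · exact ⟨Set.univ, Submodule.span_univ, fun h' => (h h').elim⟩

/-- A generating set of `K` that is finite whenever `K` is finitely generated. -/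
def economicalGenerators (K : Type*) [AddCommGroup K] [Module R K] : Set K :=
  (exists_economical_generators R K).choose

/-- The surjection onto `K` from the free module on `economicalGenerators R K`. -/
noncomputable def economicalCover (K : Type*) [AddCommGroup K] [Module R K] :
    (economicalGenerators R K →₀ R) →ₗ[R] K :=
  Finsupp.linearCombination R Subtype.val

theorem economicalCover_surjective (K : Type*) [AddCommGroup K] [Module R K] :
    Function.Surjective (economicalCover R K) := by
  rw [← LinearMap.range_eq_top, economicalCover, Finsupp.range_linearCombination,
    Subtype.range_coe]
  exact (exists_economical_generators R K).choose_spec.1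

theorem finite_economicalCover (K : Type*) [AddCommGroup K] [Module R K] [h : Module.Finite R K] :
    Module.Finite R (economicalGenerators R K →₀ R) := by
  have : Finite (economicalGenerators R K) := (exists_economical_generators R K).choose_spec.2 h
  infer_instance

/-- The iterated kernels of the economical covers, beginning with `A` itself, which is lifted to the
universe in which all the later kernels live. -/
noncomputable def economicalSyzygy (A : Type v) [AddCommGroup A] [Module R A] :
    ℕ → ModuleCat.{max u v} R
  | 0 => ModuleCat.of R (ULift.{u} A)
  | i + 1 => ModuleCat.of R (LinearMap.ker (economicalCover R (economicalSyzygy A i)))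

theorem exists_economical_resolution (A : Type v) [AddCommGroup A] [Module R A] :
    ∃ (P : ℕ → ModuleCat.{max u v} R) (d : ∀ i, P (i + 1) →ₗ[R] P i) (ε : P 0 →ₗ[R] A),
      (∀ i, Module.Free R (P i)) ∧ IsResolution (P := fun i => P i) d ε ∧
      (Module.Finite R A → Module.Finite R (P 0)) ∧
      ∀ i, (LinearMap.range (d i)).FG → Module.Finite R (P (i + 1)) := by
  let K := economicalSyzygy R A
  let P : ℕ → ModuleCat.{max u v} R := fun i => ModuleCat.of R (economicalGenerators R (K i) →₀ R)
  let p : ∀ i, P i →ₗ[R] K i := fun i => economicalCover R (K i)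
  have hp : ∀ i, Function.Surjective (p i) := fun i => economicalCover_surjective R (K i)
  let j : ∀ i, K (i + 1) →ₗ[R] P i := fun i => (LinearMap.ker (p i)).subtype
  have hj : ∀ i, Function.Injective (j i) := fun i => Subtype.val_injective
  have hjp : ∀ i, Function.Exact (j i) (p i) := fun i => (p i).exact_subtype_ker_map
  let d : ∀ i, P (i + 1) →ₗ[R] P i := fun i => (j i).comp (p (i + 1))
  have hd : ∀ i, LinearMap.range (d i) = LinearMap.ker (p i) := fun i => by
    rw [LinearMap.range_comp, LinearMap.range_eq_top.2 (hp _), Submodule.map_top]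
    exact Submodule.range_subtype _
  let e : K 0 ≃ₗ[R] A := ULift.moduleEquiv
  refine ⟨P, d, e.toLinearMap.comp (p 0), fun i => ?_, ⟨e.surjective.comp (hp 0), ?_, ?_⟩, ?_, ?_⟩
  · exact inferInstanceAs (Module.Free R (economicalGenerators R (K i) →₀ R))
  · rw [LinearMap.exact_iff, hd, LinearEquiv.ker_comp]
  · intro i
    rw [LinearMap.exact_iff, hd, LinearMap.ker_comp, LinearMap.ker_eq_bot.2 (hj i)]
    rfl
  · intro h
    have : Module.Finite R (K 0) := Module.Finite.equiv e.symm
    exact finite_economicalCover R (K 0)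
  · intro i h
    rw [hd] at h
    have : Module.Finite R (K (i + 1)) := Module.Finite.iff_fg.2 h
    exact finite_economicalCover R (K (i + 1))

variable {R}

/-- Type `FP_n` can be read off from any locally projective resolution, even if its terms are not
finitely generated. -/
theorem isTypeFP_iff_isControlled {A : Type v} [AddCommGroup A] [Module R A]
    {Q : ℕ → Type*} [∀ i, AddCommGroup (Q i)] [∀ i, Module R (Q i)]
    {d' : ∀ i, Q (i + 1) →ₗ[R] Q i} {ε' : Q 0 →ₗ[R] A}
    (hQ : IsResolution d' ε') (lQ : ∀ i, IsLocallyProjective R (Q i)) (n : ℕ) :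
    IsTypeFP R A n ↔ IsControlled R A (fun i => d' i) n := by
  constructor
  · rintro ⟨P, d, ε, hfree, hfin, h1, h2, h3⟩
    have hP : IsResolution (P := fun i => P i) d ε := ⟨h1, h2, h3⟩
    exact (isControlled_of_finite hP hfin).transfer hP hQ (fun i => .of_free) lQ
  · intro h
    obtain ⟨P, d, ε, hfree, hP, h0, hs⟩ := exists_economical_resolution R A
    exact ⟨P, d, ε, hfree, (h.transfer hQ hP lQ fun i => .of_free).finite h0 hs,
      hP.surjective, hP.exact_zero, hP.exact_succ⟩

end EconomicalResolution

/-! ### Values of characters -/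

namespace NontrivialCharacter

variable {G : Type u} [Group G]

theorem eval_mul (χ : NontrivialCharacter G) (g h : G) :
    χ.eval (g * h) = χ.eval g + χ.eval h := by
  simp [eval]

theorem eval_inv (χ : NontrivialCharacter G) (g : G) : χ.eval g⁻¹ = -χ.eval g := by
  simp [eval]

theorem eval_pow (χ : NontrivialCharacter G) (g : G) (n : ℕ) :
    χ.eval (g ^ n) = n * χ.eval g := by
  simp [eval]

theorem ext_eval {χ ψ : NontrivialCharacter G} (h : ∀ g, χ.eval g = ψ.eval g) : χ = ψ :=
  Subtype.ext (AddMonoidHom.ext fun g => h g.toMul)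

theorem exists_eval_pos (χ : NontrivialCharacter G) : ∃ t : G, 0 < χ.eval t := by
  obtain ⟨g, hg⟩ : ∃ g, χ.eval g ≠ 0 := by
    by_contra! h
    exact χ.2 (AddMonoidHom.ext fun g => h g.toMul)
  rcases hg.lt_or_gt with h | h
  · exact ⟨g⁻¹, by rw [eval_inv]; linarith⟩
  · exact ⟨g, h⟩

theorem exists_forall_le_eval_pow (χ : NontrivialCharacter G) {t : G} (ht : 0 < χ.eval t)
    (F : Set G) (hF : F.Finite) : ∃ m : ℕ, ∀ g ∈ F, χ.eval g ≤ χ.eval (t ^ m) := by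
  obtain ⟨c, hc⟩ := (hF.image χ.eval).bddAbove
  obtain ⟨m, hm⟩ := Archimedean.arch c ht
  refine ⟨m, fun g hg => (hc ⟨g, hg, rfl⟩).trans ?_⟩
  rwa [eval_pow, ← nsmul_eq_mul]

theorem mem_subring {χ : NontrivialCharacter G} {r : MonoidAlgebra ℤ G} :
    r ∈ χ.subring ↔ ∀ g ∈ r.coeff.support, 0 ≤ χ.eval g := Iff.rfl

theorem of_mem_subring {χ : NontrivialCharacter G} {g : G} (hg : 0 ≤ χ.eval g) :
    MonoidAlgebra.of ℤ G g ∈ χ.subring := by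
  intro h hh
  have : h = g := by simpa [MonoidAlgebra.of_apply] using hh
  rwa [this]

end NontrivialCharacter

/-! ### Free modules over the group ring are locally projective over `ℤG_χ` -/

section GroupRing

variable {G : Type u} [Group G] {M : Type*} [AddCommGroup M] [Module (MonoidAlgebra ℤ G) M]

/-- An additive subgroup contains `r • x` as soon as it contains `g • x` for all `g` in the support
of `r`. -/
theorem smul_mem_of_of_smul_mem (N : AddSubgroup M) (r : MonoidAlgebra ℤ G) (x : M)
    (h : ∀ g ∈ r.coeff.support, MonoidAlgebra.of ℤ G g • x ∈ N) : r • x ∈ N := by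
  rw [← MonoidAlgebra.sum_coeff_single r, Finsupp.sum, Finset.sum_smul]
  refine sum_mem fun g hg => ?_
  have : MonoidAlgebra.single g (r.coeff g) = r.coeff g • MonoidAlgebra.of ℤ G g := by
    simp [MonoidAlgebra.smul_single]
  rw [this, smul_assoc]
  exact zsmul_mem (h g hg) _

/-- A free `ℤG`-module with basis `b` is the directed union of the free `ℤG_χ`-modules spanned by
finitely many of the elements `t⁻ᵐ b j`, where `χ(t) > 0`: right multiplication by a high power of
`t` moves any element of `ℤG` into `ℤG_χ`. -/
theorem isLocallyProjective_subring [Module.Free (MonoidAlgebra ℤ G) M]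
    (χ : NontrivialCharacter G) : IsLocallyProjective χ.subring M := by
  classical
  rintro _ ⟨T, rfl⟩
  let b := Module.Free.chooseBasis (MonoidAlgebra ℤ G) M
  let J := T.biUnion fun x => (b.repr x).support
  obtain ⟨t, ht⟩ := χ.exists_eval_pos
  let F : Finset G := T.biUnion fun x => J.biUnion fun j => (b.repr x j).coeff.support
  obtain ⟨m, hm⟩ := χ.exists_forall_le_eval_pow ht _ (F.finite_toSet.image (·⁻¹))
  let w : (MonoidAlgebra ℤ G)ˣ := Units.map (MonoidAlgebra.of ℤ G) (toUnits (t ^ m))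
  let v : J → M := (fun _ : J => w⁻¹) • fun j : J => b j
  have hli : LinearIndependent χ.subring v :=
    ((b.linearIndependent.comp _ Subtype.val_injective).units_smul _).restrict_scalars
      fun r s h => Subtype.ext (by simpa [Subring.smul_def] using h)
  refine ⟨Submodule.span _ (Set.range v), ?_, Submodule.fg_span (Set.finite_range _),
    Module.Projective.of_basis (Module.Basis.span hli)⟩
  rw [Submodule.span_le]
  intro x hx
  rw [← b.linearCombination_repr x, Finsupp.linearCombination_apply, Finsupp.sum]
  refine Submodule.sum_mem _ fun j hj => ?_
  have hjJ : j ∈ J := Finset.mem_biUnion.2 ⟨x, hx, hj⟩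
  have hmem : b.repr x j * MonoidAlgebra.of ℤ G (t ^ m) ∈ χ.subring := by
    intro g hg
    obtain ⟨g', hg', rfl⟩ : ∃ g' ∈ (b.repr x j).coeff.support, g' * t ^ m = g := by
      refine ⟨g * (t ^ m)⁻¹, ?_, by group⟩
      simpa [MonoidAlgebra.of_apply, MonoidAlgebra.coeff_mul_single_apply] using hg
    have := hm g'⁻¹ ⟨g', Finset.mem_biUnion.2 ⟨x, hx, Finset.mem_biUnion.2 ⟨j, hjJ, hg'⟩⟩, rfl⟩
    rw [χ.eval_inv] at this
    rw [χ.eval_mul]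
    linarith
  have : b.repr x j • b j = (⟨_, hmem⟩ : χ.subring) • v ⟨j, hjJ⟩ := by
    change _ = (b.repr x j * (w : MonoidAlgebra ℤ G)) • w⁻¹ • b j
    rw [mul_smul, Units.smul_def w⁻¹, ← mul_smul (w : MonoidAlgebra ℤ G), Units.mul_inv, one_smul]
  rw [this]
  exact Submodule.smul_mem _ _ (Submodule.subset_span ⟨_, rfl⟩)

end GroupRing

/-! ### Restriction of modules to a subgroup of finite index -/

section Subgroup

variable {G : Type u} [Group G] (H : Subgroup G)

/-- Representatives of the right cosets of `H` form a basis of `ℤG` over `ℤH`. -/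
theorem free_restrict {M : Type*} [AddCommGroup M]
    [Module (MonoidAlgebra ℤ G) M] [Module (MonoidAlgebra ℤ H) M]
    (hM : ∀ (r : MonoidAlgebra ℤ H) (x : M),
      r • x = MonoidAlgebra.mapDomainRingHom ℤ H.subtype r • x)
    [Module.Free (MonoidAlgebra ℤ G) M] : Module.Free (MonoidAlgebra ℤ H) M := by
  classical
  let : Module (MonoidAlgebra ℤ H) (MonoidAlgebra ℤ G) :=
    Module.compHom _ (MonoidAlgebra.mapDomainRingHom ℤ H.subtype)
  have hsmul : ∀ (r : MonoidAlgebra ℤ H) (x : MonoidAlgebra ℤ G),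
    r • x = MonoidAlgebra.mapDomainRingHom ℤ H.subtype r * x := fun _ _ => rfl
  have : IsScalarTower (MonoidAlgebra ℤ H) (MonoidAlgebra ℤ G) M :=
    ⟨fun r s x => by rw [hM, hsmul, mul_smul]⟩
  let Q := Quotient (QuotientGroup.rightRel H)
  let t : Q → G := Quotient.out
  let v : Q → MonoidAlgebra ℤ G := fun q => MonoidAlgebra.of ℤ G (t q)
  have hli : LinearIndependent (MonoidAlgebra ℤ H) v := by
    rw [linearIndependent_iff]
    intro l hl
    ext q h
    -- The translates `ℤH t_q` have disjoint supports, so the coefficient at `h t_q` isolates `l q`.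
    have key : ∀ q', (l q' • v q').coeff (h * t q) = if q' = q then (l q).coeff h else 0 := by
      intro q'
      have h1 : (l q' • v q').coeff (h * t q) =
          (MonoidAlgebra.mapDomainRingHom ℤ H.subtype (l q')).coeff (h * t q * (t q')⁻¹) := by
        rw [hsmul]
        simp [v, MonoidAlgebra.coeff_mul_single_apply]
      rw [h1]
      split_ifs with hq
      · subst hq
        simp
      · rw [MonoidAlgebra.mapDomainRingHom_apply, MonoidAlgebra.coeff_mapDomain]
        refine Finsupp.mapDomain_of_notMem_range _ _ ?_
        rintro ⟨k, hk⟩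
        refine hq ?_
        have : QuotientGroup.rightRel H (t q') (t q) := by
          rw [QuotientGroup.rightRel_apply]
          have h2 : t q * (t q')⁻¹ = (h : G)⁻¹ * k := by
            rw [show (k : G) = h * t q * (t q')⁻¹ from hk]; group
          rw [h2]
          exact H.mul_mem (H.inv_mem h.2) k.2
        simpa [t] using Quotient.sound this
    have := congrArg (fun x : MonoidAlgebra ℤ G => x.coeff (h * t q)) hl
    simp only [Finsupp.linearCombination_apply, Finsupp.sum, MonoidAlgebra.coeff_sum,
      Finsupp.finsetSum_apply, key] at this
    by_contra hne
    have hq : q ∈ l.support := by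
      rw [Finsupp.mem_support_iff]
      rintro h0
      simp [h0] at hne
    rw [Finset.sum_ite_eq', if_pos hq] at this
    exact hne this
  have hsp : ⊤ ≤ Submodule.span (MonoidAlgebra ℤ H) (Set.range v) := by
    rintro x -
    have := smul_mem_of_of_smul_mem (Submodule.span (MonoidAlgebra ℤ H) (Set.range v)).toAddSubgroup
      x 1 ?_
    · simpa using this
    intro g _
    have hg : g * (t (Quotient.mk _ g))⁻¹ ∈ H :=
      QuotientGroup.rightRel_apply.1 (Quotient.mk_out (s := QuotientGroup.rightRel H) g)
    have : MonoidAlgebra.of ℤ G g • (1 : MonoidAlgebra ℤ G) =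
        MonoidAlgebra.of ℤ H ⟨_, hg⟩ • v (Quotient.mk _ g) := by
      rw [hsmul]
      simp [v]
    rw [this]
    exact Submodule.smul_mem _ _ (Submodule.subset_span ⟨_, rfl⟩)
  exact Module.Free.of_basis
    ((Module.Basis.mk hli hsp).smulTower (Module.Free.chooseBasis (MonoidAlgebra ℤ G) M))

/-- The rings `ℤG_χ` and `ℤH_χ` have the same bounded sets in a `ℤG`-module. In general `ℤG_χ` is not
finitely generated over `ℤH_χ`, but it lies in the sum of the finitely many modules
`ℤH_χ t⁻ᵐ t_q`, where the `t_q` represent the cosets `H g`, `t ∈ H` has `χ(t) > 0`, and `m` is so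
large that `χ(t_q) ≤ m χ(t)` for all `q`. -/
theorem isFGBounded_restrict_iff [H.FiniteIndex] {M : Type*} [AddCommGroup M]
    [Module (MonoidAlgebra ℤ G) M] [Module (MonoidAlgebra ℤ H) M]
    (hM : ∀ (r : MonoidAlgebra ℤ H) (x : M),
      r • x = MonoidAlgebra.mapDomainRingHom ℤ H.subtype r • x)
    {χ : NontrivialCharacter G} {ψ : NontrivialCharacter H}
    (hψ : ∀ h : H, ψ.eval h = χ.eval h) (X : Set M) :
    IsFGBounded ψ.subring X ↔ IsFGBounded χ.subring X := by
  classical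
  have hM' : ∀ (h : H) (x : M), MonoidAlgebra.of ℤ H h • x = MonoidAlgebra.of ℤ G h • x :=
    fun h x => by rw [hM]; simp
  constructor
  · rintro ⟨_, ⟨T, rfl⟩, hX⟩
    refine ⟨Submodule.span χ.subring T, ⟨T, rfl⟩, fun x hx => ?_⟩
    replace hx := hX hx
    induction hx using Submodule.span_induction with
    | mem x hx => exact Submodule.subset_span hx
    | zero => exact zero_mem _
    | add x y _ _ hx hy => exact add_mem hx hy
    | smul r x _ hx =>
      refine smul_mem_of_of_smul_mem (Submodule.span χ.subring (T : Set M)).toAddSubgroup r.1 x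
        fun h hh => ?_
      rw [hM']
      exact Submodule.smul_mem _
        (⟨_, χ.of_mem_subring (hψ h ▸ r.2 h hh)⟩ : χ.subring) hx
  · rintro ⟨_, ⟨T, rfl⟩, hX⟩
    obtain ⟨t, ht⟩ := ψ.exists_eval_pos
    let Q := Quotient (QuotientGroup.rightRel H)
    have : Finite Q := Finite.of_equiv _ (QuotientGroup.quotientRightRelEquivQuotientLeftRel H).symm
    let τ : Q → G := Quotient.out
    obtain ⟨m, hm⟩ := χ.exists_forall_le_eval_pow (t := t) (hψ t ▸ ht) _ (Set.finite_range τ)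
    let Y : Set M := (fun p : Q × M => MonoidAlgebra.of ℤ G ((t ^ m : G)⁻¹ * τ p.1) • p.2) ''
      (Set.univ ×ˢ T)
    have hY : Y.Finite := (Set.finite_univ.prod T.finite_toSet).image _
    refine ⟨Submodule.span ψ.subring Y, Submodule.fg_span hY, fun x hx => ?_⟩
    obtain ⟨f, -, rfl⟩ := Submodule.mem_span_finset.1 (hX hx)
    refine Submodule.sum_mem _ fun x hx => ?_
    refine smul_mem_of_of_smul_mem (Submodule.span ψ.subring Y).toAddSubgroup (f x).1 x
      fun g hg => ?_
    let q : Q := Quotient.mk _ g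
    have hgq : g * (τ q)⁻¹ ∈ H :=
      QuotientGroup.rightRel_apply.1 (Quotient.mk_out (s := QuotientGroup.rightRel H) g)
    let h : H := ⟨_, hgq⟩ * t ^ m
    have hh : 0 ≤ ψ.eval h := by
      have h1 : 0 ≤ χ.eval g := (f x).2 g hg
      have h2 := hm (τ q) ⟨q, rfl⟩
      rw [hψ]
      simp only [h, Subgroup.coe_mul, Subgroup.coe_pow, χ.eval_mul, χ.eval_inv]
      linarith
    have : MonoidAlgebra.of ℤ G g • x =
        (⟨_, ψ.of_mem_subring hh⟩ : ψ.subring) •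
          MonoidAlgebra.of ℤ G ((t ^ m : G)⁻¹ * τ q) • x := by
      rw [Subring.smul_def, hM', ← mul_smul, ← map_mul]
      simp [h, mul_assoc]
    rw [this]
    exact Submodule.smul_mem _ _ (Submodule.subset_span ⟨(q, x), ⟨trivial, hx⟩, rfl⟩)

theorem isControlled_restrict_iff [H.FiniteIndex]
    {A : Type*} [AddCommGroup A] [Module (MonoidAlgebra ℤ G) A] [Module (MonoidAlgebra ℤ H) A]
    (hA : ∀ (r : MonoidAlgebra ℤ H) (x : A),
      r • x = MonoidAlgebra.mapDomainRingHom ℤ H.subtype r • x)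
    {P : ℕ → Type*} [∀ i, AddCommGroup (P i)] [∀ i, Module (MonoidAlgebra ℤ G) (P i)]
    [∀ i, Module (MonoidAlgebra ℤ H) (P i)]
    (hP : ∀ i (r : MonoidAlgebra ℤ H) (x : P i),
      r • x = MonoidAlgebra.mapDomainRingHom ℤ H.subtype r • x)
    {χ : NontrivialCharacter G} {ψ : NontrivialCharacter H}
    (hψ : ∀ h : H, ψ.eval h = χ.eval h) (d : ∀ i, P (i + 1) → P i) (n : ℕ) :
    IsControlled ψ.subring A d n ↔ IsControlled χ.subring A d n := by
  simp only [IsControlled, isFGBounded_restrict_iff H hA hψ,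
    fun i X => isFGBounded_restrict_iff H (hP i) hψ X]

theorem isTypeFP_subring_iff {A : Type v} [AddCommGroup A] [Module (MonoidAlgebra ℤ G) A]
    {P : ℕ → Type*} [∀ i, AddCommGroup (P i)] [∀ i, Module (MonoidAlgebra ℤ G) (P i)]
    [∀ i, Module.Free (MonoidAlgebra ℤ G) (P i)]
    {d : ∀ i, P (i + 1) →ₗ[MonoidAlgebra ℤ G] P i} {ε : P 0 →ₗ[MonoidAlgebra ℤ G] A}
    (hP : IsResolution d ε) (χ : NontrivialCharacter G) (n : ℕ) :
    IsTypeFP χ.subring A n ↔ IsControlled χ.subring A (fun i => d i) n :=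
  isTypeFP_iff_isControlled (d' := fun i => (d i).restrictScalars χ.subring)
    (ε' := ε.restrictScalars χ.subring) ⟨hP.surjective, hP.exact_zero, hP.exact_succ⟩
    (fun _ => isLocallyProjective_subring χ) n

/-- A `ℤG`-module is of type `FP_n` over `ℤH_χ` if and only if it is so over `ℤG_χ`: a free resolution
over `ℤG` is one over `ℤH`, and it computes both properties by the same condition on bounded
sets. -/
theorem isTypeFP_restrict_iff [H.FiniteIndex] (A : Type v) [AddCommGroup A]
    [Module (MonoidAlgebra ℤ G) A] {χ : NontrivialCharacter G} {ψ : NontrivialCharacter H}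
    (hψ : ∀ h : H, ψ.eval h = χ.eval h) (n : ℕ) :
    letI : Module (MonoidAlgebra ℤ H) A :=
      Module.compHom A (MonoidAlgebra.mapDomainRingHom ℤ H.subtype)
    IsTypeFP ψ.subring A n ↔ IsTypeFP χ.subring A n := by
  let φ := MonoidAlgebra.mapDomainRingHom ℤ H.subtype
  obtain ⟨P, d, ε, hfree, hP, -⟩ := exists_economical_resolution (MonoidAlgebra ℤ G) A
  let : Module (MonoidAlgebra ℤ H) A := Module.compHom A φ
  let : ∀ i, Module (MonoidAlgebra ℤ H) (P i) := fun i => Module.compHom (P i) φ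
  have : ∀ i, Module.Free (MonoidAlgebra ℤ H) (P i) := fun i => free_restrict H fun _ _ => rfl
  let d' : ∀ i, P (i + 1) →ₗ[MonoidAlgebra ℤ H] P i := fun i =>
    { toFun := d i
      map_add' := (d i).map_add
      map_smul' := fun r x => (d i).map_smul (φ r) x }
  let ε' : P 0 →ₗ[MonoidAlgebra ℤ H] A :=
    { toFun := ε
      map_add' := ε.map_add
      map_smul' := fun r x => ε.map_smul (φ r) x }
  have hP' : IsResolution (P := fun i => P i) d' ε' :=
    ⟨hP.surjective, hP.exact_zero, hP.exact_succ⟩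
  rw [isTypeFP_subring_iff (P := fun i => P i) hP' ψ n,
    isTypeFP_subring_iff (P := fun i => P i) hP χ n]
  exact isControlled_restrict_iff (P := fun i => P i) H (fun _ _ => rfl) (fun _ _ _ => rfl) hψ
    (fun i => d i) n

end Subgroup

/-! ### Restriction of characters to a subgroup of finite index -/

section Characters

/-- Let `f : M → N` have cokernel of finite exponent, with `M` and `N` of the same finite rank. Then
`ker f` has rank zero, so it is torsion and killed by every homomorphism to `ℝ`; as `ℝ` is
divisible and torsion-free, such a homomorphism extends along `f`. -/
theorem exists_extension_of_rank_eq {M N : Type u} [AddCommGroup M] [AddCommGroup N]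
    [Module.Finite ℤ M] (f : M →ₗ[ℤ] N) {k : ℕ} (hk : k ≠ 0)
    (hf : ∀ x, k • x ∈ LinearMap.range f) (hrank : Module.rank ℤ N = Module.rank ℤ M)
    (ψ : M →+ ℝ) : ∃ χ : N →+ ℝ, ∀ x, χ (f x) = ψ x := by
  have hcoker : Module.rank ℤ (N ⧸ LinearMap.range f) = 0 := by
    rw [rank_eq_zero_iff]
    intro x
    obtain ⟨x, rfl⟩ := Submodule.Quotient.mk_surjective _ x
    refine ⟨k, by exact_mod_cast hk, ?_⟩
    rw [← Submodule.Quotient.mk_smul, Submodule.Quotient.mk_eq_zero]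
    simpa using hf x
  have h1 := rank_quotient_add_rank_of_isDomain (LinearMap.range f)
  rw [hcoker, zero_add, hrank] at h1
  have h2 := rank_quotient_add_rank_of_isDomain (LinearMap.ker f)
  rw [f.quotKerEquivRange.rank_eq, h1] at h2
  have hker : Module.rank ℤ (LinearMap.ker f) = 0 := by
    refine Cardinal.eq_of_add_eq_add_left (b := Module.rank ℤ (LinearMap.ker f)) (c := 0)
      (by rw [h2, add_zero]) ?_
    exact Module.rank_lt_aleph0 ℤ M
  have hψ : ∀ x, f x = 0 → ψ x = 0 := by
    intro x hx
    obtain ⟨a, ha, hax⟩ := rank_eq_zero_iff.1 hker ⟨x, hx⟩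
    have : (a : ℝ) * ψ x = 0 := by
      rw [← zsmul_eq_mul, ← map_zsmul, show a • x = 0 from congrArg Subtype.val hax, map_zero]
    exact (mul_eq_zero.1 this).resolve_left (by exact_mod_cast ha)
  have hψ' : ∀ x y, f x = f y → ψ x = ψ y := fun x y h =>
    sub_eq_zero.1 (by rw [← map_sub]; exact hψ _ (by rw [map_sub, h, sub_self]))
  have hk' : (k : ℝ) ≠ 0 := by exact_mod_cast hk
  choose s hs using hf
  refine ⟨AddMonoidHom.mk' (fun x => ψ (s x) / k) fun x y => ?_, fun x => ?_⟩
  · rw [← add_div, ← map_add]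
    congr 1
    exact hψ' _ _ (by rw [map_add, hs, hs, hs, smul_add])
  · change ψ (s (f x)) / k = ψ x
    rw [div_eq_iff hk', hψ' (s (f x)) (k • x) (by rw [hs, map_nsmul]), map_nsmul, nsmul_eq_mul,
      mul_comm]

variable {G : Type u} [Group G] (H : Subgroup G) [H.FiniteIndex]

/-- Every character of `H` extends to `G`, provided that the abelianisations have the same rank. -/
theorem exists_restrictCharacter_eq [Group.FG G] (hrank : abRank G = abRank H)
    (ψ : Additive H →+ ℝ) : ∃ χ : Additive G →+ ℝ, restrictCharacter H χ = ψ := by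
  have : Group.FG (Abelianization H) :=
    Group.fg_of_surjective (f := Abelianization.of (G := H)) (Quotient.mk_surjective)
  have : Module.Finite ℤ (Additive (Abelianization H)) :=
    Module.Finite.iff_addGroup_fg.2 inferInstance
  obtain ⟨χ, hχ⟩ := exists_extension_of_rank_eq
    (MonoidHom.toAdditive (Abelianization.map H.subtype)).toIntLinearMap
    -- Some `g ^ m` with `0 < m ≤ [G : H]` lies in `H`, hence so does `g ^ [G : H]!`.
    (k := H.index.factorial) (Nat.factorial_ne_zero _) (by
      intro x
      obtain ⟨g, hg⟩ : ∃ g, Abelianization.of g = x.toMul := Quotient.mk_surjective x.toMul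
      have h := H.pow_mem_of_index_ne_zero_of_dvd H.index_ne_zero_of_finite g
        (n := H.index.factorial) fun m hm hle => Nat.dvd_factorial hm hle
      refine ⟨Additive.ofMul (Abelianization.of ⟨_, h⟩), ?_⟩
      change Abelianization.of (g ^ H.index.factorial) = x.toMul ^ H.index.factorial
      rw [map_pow, hg]) hrank
    (MonoidHom.toAdditiveLeft (Abelianization.lift (AddMonoidHom.toMultiplicativeRight ψ)))
  refine ⟨χ.comp (MonoidHom.toAdditive Abelianization.of), ?_⟩
  exact AddMonoidHom.ext fun h => hχ (Additive.ofMul (Abelianization.of h.toMul))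

theorem Subgroup.exists_ne_zero_pow_mem (g : G) : ∃ k : ℕ, k ≠ 0 ∧ g ^ k ∈ H := by
  obtain ⟨k, hk, -, h⟩ := Subgroup.exists_pow_mem_of_index_ne_zero H.index_ne_zero_of_finite g
  exact ⟨k, hk.ne', h⟩

namespace NontrivialCharacter

/-- The restriction `χ|_H` to a subgroup of finite index, which is again nontrivial because each
element of `G` has a positive power in `H`. -/
def restrict (χ : NontrivialCharacter G) : NontrivialCharacter H :=
  ⟨restrictCharacter H χ.1, by
    intro h
    obtain ⟨g, hg⟩ := χ.exists_eval_pos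
    obtain ⟨k, hk, hkg⟩ := H.exists_ne_zero_pow_mem g
    have h0 : χ.eval (g ^ k) = 0 := DFunLike.congr_fun h (Additive.ofMul ⟨g ^ k, hkg⟩)
    rw [χ.eval_pow] at h0
    have : (0 : ℝ) < k := by positivity
    exact (mul_pos this hg).ne' h0⟩

theorem eval_restrict (χ : NontrivialCharacter G) (h : H) :
    (χ.restrict H).eval h = χ.eval h := rfl

variable {H} in
/-- A character is determined by its restriction to a subgroup of finite index, through a formula
that also shows its continuous dependence on the restriction. -/
theorem eval_eq_div (χ : NontrivialCharacter G) {g : G} {k : ℕ} (hk : k ≠ 0) (hg : g ^ k ∈ H) :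
    χ.eval g = (χ.restrict H).eval ⟨g ^ k, hg⟩ / k := by
  rw [eval_restrict, χ.eval_pow, mul_div_cancel_left₀]
  exact_mod_cast hk

theorem continuous_eval (g : G) :
    Continuous fun χ : NontrivialCharacter G => χ.eval g :=
  (continuous_apply g).comp continuous_induced_dom

theorem continuous_iff {X : Type*} [TopologicalSpace X] {f : X → NontrivialCharacter G} :
    Continuous f ↔ ∀ g, Continuous fun x => (f x).eval g :=
  continuous_induced_rng.trans continuous_pi_iff

theorem restrict_bijective [Group.FG G] (hrank : abRank G = abRank H) :
    Function.Bijective (restrict (G := G) H) := by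
  refine ⟨fun χ ψ h => ext_eval fun g => ?_, fun ψ => ?_⟩
  · obtain ⟨k, hk, hg⟩ := H.exists_ne_zero_pow_mem g
    rw [χ.eval_eq_div hk hg, ψ.eval_eq_div hk hg, h]
  · obtain ⟨χ, hχ⟩ := exists_restrictCharacter_eq H hrank ψ.1
    refine ⟨⟨χ, ?_⟩, Subtype.ext hχ⟩
    rintro rfl
    exact ψ.2 hχ.symm

/-- Restriction to `H` as a homeomorphism between the spaces of nontrivial characters. -/
noncomputable def restrictHomeomorph [Group.FG G] (hrank : abRank G = abRank H) :
    NontrivialCharacter G ≃ₜ NontrivialCharacter H where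
  toEquiv := Equiv.ofBijective (restrict H) (restrict_bijective H hrank)
  continuous_toFun := continuous_iff.2 fun h => continuous_eval (h : G)
  continuous_invFun := by
    refine continuous_iff.2 fun g => ?_
    obtain ⟨k, hk, hg⟩ := H.exists_ne_zero_pow_mem g
    refine ((continuous_eval (⟨g ^ k, hg⟩ : H)).div_const k).congr fun ψ => ?_
    rw [eval_eq_div _ hk hg]
    congr 2
    exact (Equiv.ofBijective_apply_symm_apply (restrict H) (restrict_bijective H hrank) ψ).symm

theorem restrict_equiv_restrict_iff (χ ψ : NontrivialCharacter G) :
    χ.restrict H ≈ ψ.restrict H ↔ χ ≈ ψ := by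
  constructor
  · rintro ⟨a, ha, h⟩
    refine ⟨a, ha, fun g => ?_⟩
    obtain ⟨k, hk, hg⟩ := H.exists_ne_zero_pow_mem g
    rw [χ.eval_eq_div hk hg, ψ.eval_eq_div hk hg, h, mul_div_assoc]
  · rintro ⟨a, ha, h⟩
    exact ⟨a, ha, fun g => h g⟩

end NontrivialCharacter

/-- The homeomorphism `[χ] ↦ [χ|_H]` of character spheres. -/
noncomputable def CharacterSphere.restrictHomeomorph [Group.FG G] (hrank : abRank G = abRank H) :
    CharacterSphere G ≃ₜ CharacterSphere H :=
  let e := NontrivialCharacter.restrictHomeomorph H hrank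
  { toEquiv := Quotient.congr e.toEquiv fun χ ψ =>
      (NontrivialCharacter.restrict_equiv_restrict_iff H χ ψ).symm
    continuous_toFun := continuous_quot_lift _ (continuous_quot_mk.comp e.continuous)
    continuous_invFun := continuous_quot_lift _ (continuous_quot_mk.comp e.symm.continuous) }

end Characters

theorem theorem1p5 {G : Type u} [Group G] [Group.FG G] (H : Subgroup G) [H.FiniteIndex]
    (hrank : abRank G = abRank H)
    (A : Type v) [AddCommGroup A] [Module (MonoidAlgebra ℤ G) A] :
    ∃ f : CharacterSphere G ≃ₜ CharacterSphere H,
      (∀ (χ : Additive G →+ ℝ) (hχ : χ ≠ 0),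
        ∃ hχH : restrictCharacter H χ ≠ 0,
          f (CharacterSphere.mk χ hχ) = CharacterSphere.mk (restrictCharacter H χ) hχH) ∧
      ∀ n : ℕ, IsTypeFP (MonoidAlgebra ℤ G) A n →
        f '' sigmaInvariant n G A = sigmaInvariantSubgroup n H A := by
  refine ⟨CharacterSphere.restrictHomeomorph H hrank, fun χ hχ =>
    ⟨(NontrivialCharacter.restrict H ⟨χ, hχ⟩).2, rfl⟩, fun n _ => ?_⟩
  refine Set.ext fun s => ?_
  obtain ⟨c, rfl⟩ := (CharacterSphere.restrictHomeomorph H hrank).surjective s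
  rw [(CharacterSphere.restrictHomeomorph H hrank).injective.mem_set_image]
  induction c using Quotient.inductionOn with
  | h χ => exact (isTypeFP_restrict_iff H A (ψ := χ.restrict H) (fun _ => rfl) n).symm
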